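/- **Setting.** A hypergraph $H=(V,E)$ has a finite vertex set $V$ and a set $E$ of edges $e\subseteq V$. Its rank $r$ is the maximum size of an edge, its maximum degree $\Delta$ is the maximum number of edges containing a vertex, and $n=|V|$. The distance $\mathrm{dist}(u,v)$ is the minimum number of edges in a contiguous path between $u$ and $v$ ($\infty$ if there is none). A set $S\subseteq V$ is a $(2,b)$-ruling set if $\mathrm{dist}(u,v)\ge 2$ for all distinct $u,v\in S$ and every $v\in V$ has some $u\in S$ with $\mathrm{dist}(v,u)\le b$. In the LOCAL model every vertex has a unique ID from $\{0,\dots,n^c\}$, where $c$ is a constant, and initially knows its ID, the edges containing it and the IDs of the vertices in these edges; it also knows the global parameters. In each synchronous round every vertex sends a message of arbitrary size to each neighbour (the vertices sharing an edge with it), receives the messages of its neighbours and performs arbitrary local computation. After the last round each vertex decides whether it belongs to the output. The number $\log^* n$ is the number of times $\log_2$ has to be applied to $n$ to reach a value at most $1$. **Theorem.** For every $c$ there is a constant $C$, depending only on $c$, such that the following hold. 1. For all $n,\Delta,r$ there are a deterministic LOCAL algorithm and an integer $b\le C\log r$ such that the algorithm finds a $(2,b)$-ruling set in every $n$-vertex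 hypergraph of maximum degree $\Delta$ and rank $r$, for every assignment of IDs, within $C(\Delta\log r+\log^* n)$ rounds. That is, a $(2,O(\log r))$-ruling set can be found in $O(\Delta\log r+\log^* n)$ rounds. 2. For all $n,\Delta,r$ and all $k\ge 1$ there is a deterministic LOCAL algorithm that finds a $(2,k)$-ruling set in every $n$-vertex hypergraph of maximum degree $\Delta$ and rank $r$, for every assignment of IDs, within $C\bigl(\Delta\bigl(k+(2/3)^{k-1}r\bigr)+\log^* n\bigr)$ rounds. That is, a $(2,k)$-ruling set can be found in $O(\Delta(k+(2/3)^{k-1}r)+\log^* n)$ rounds. -/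

import Mathlib

universe u

/-- The iterated base-two logarithm `log* n`: how often `x ↦ log₂ x` has to be applied to `n` until
the value is at most `1`. Rounding up after each step does not change this number. -/
def logStar (n : ℕ) : ℕ :=
  if _h : n ≤ 1 then 0 else logStar (Nat.clog 2 n) + 1
termination_by n
decreasing_by
  refine lt_of_le_of_lt (b := n - 1) ?_ (by omega)
  refine Nat.clog_le_of_le_pow ?_
  have h := Nat.lt_two_pow_self (n := n - 1)
  omega

namespace Hypergraph

variable {α : Type u}

/-- The rank of a (finite) hypergraph: the maximum number of vertices of an edge
(`0` if there are no edges). -/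
noncomputable def rank (H : Hypergraph α) : ℕ :=
  sSup (Set.ncard '' H.edgeSet)

/-- The degree of a vertex: the number of edges that contain it. -/
noncomputable def degree (H : Hypergraph α) (v : α) : ℕ :=
  {e ∈ H.edgeSet | v ∈ e}.ncard

/-- The maximum degree of a (finite) hypergraph (`0` if there are no vertices). -/
noncomputable def maxDegree (H : Hypergraph α) : ℕ :=
  sSup (H.degree '' H.vertexSet)

/-- The underlying graph: every hyperedge is replaced by a clique on its vertices. -/
def underlyingGraph (H : Hypergraph α) : SimpleGraph α where
  Adj u v := u ≠ v ∧ H.Adj u v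
  symm := ⟨fun _ _ h => ⟨h.1.symm, h.2.symm⟩⟩
  loopless := ⟨fun _ h => h.1 rfl⟩

/-- The distance of two vertices: the minimum number of hyperedges in a contiguous path between
them, that is, the length of a shortest walk along which consecutive vertices share a hyperedge
(`⊤` if there is none). -/
noncomputable def dist (H : Hypergraph α) (u v : α) : ℕ∞ :=
  H.underlyingGraph.edist u v

/-- `S` is an `(a, b)`-ruling set of `H`: two different vertices of `S` have distance at least `a`,
and every vertex of `H` has distance at most `b` from some vertex of `S`. -/
def IsRulingSet (H : Hypergraph α) (a b : ℕ) (S : Set α) : Prop :=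
  S ⊆ H.vertexSet ∧
  (∀ u ∈ S, ∀ v ∈ S, u ≠ v → (a : ℕ∞) ≤ H.dist u v) ∧
  (∀ v ∈ H.vertexSet, ∃ u ∈ S, H.dist v u ≤ (b : ℕ∞))

end Hypergraph

/-- A deterministic algorithm in the LOCAL model in which every vertex finally decides whether it
belongs to the output set. All vertices run the same code. Local computation and message size are
unbounded. -/
structure LocalAlgorithm where
  /-- The local states of a vertex. -/
  State : Type
  /-- The messages. -/
  Msg : Type
  /-- The initial state, computed from the vertex's own ID and its local neighbourhood: the edges
  that contain it, each given as the set of the IDs of its vertices. -/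
  init : ℕ → Set (Set ℕ) → State
  /-- The message that a vertex in a given state sends to its neighbour with a given ID. -/
  send : State → ℕ → Msg
  /-- The new state, computed from the old one and the received messages, each of them paired
  with the ID of its sender. -/
  receive : State → Set (ℕ × Msg) → State
  /-- The final decision: does the vertex belong to the output set? -/
  accept : State → Prop

namespace LocalAlgorithm

variable {α : Type u}

/-- The state of every vertex after `t` synchronous rounds on the network `H` with IDs `ident`. -/
def run (A : LocalAlgorithm) (H : Hypergraph α) (ident : α → ℕ) : ℕ → α → A.State
  | 0, v => A.init (ident v) ((fun e => ident '' e) '' {e ∈ H.edgeSet | v ∈ e})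
  | t + 1, v => A.receive (A.run H ident t v)
      {p | ∃ w, H.underlyingGraph.Adj v w ∧
        p = (ident w, A.send (A.run H ident t w) (ident v))}

/-- The set that the algorithm has computed after `t` rounds. -/
def outputSet (A : LocalAlgorithm) (H : Hypergraph α) (ident : α → ℕ) (t : ℕ) : Set α :=
  {v ∈ H.vertexSet | A.accept (A.run H ident t v)}

/-- Within `T` rounds `A` finds an `(a, b)`-ruling set in every hypergraph with `n` vertices, maximum
degree `Δ` and rank `r`, for every assignment of unique IDs of size at most `n ^ c`. -/
def FindsRulingSet (A : LocalAlgorithm) (c n Δ r a b T : ℕ) : Prop :=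
  ∀ (α : Type u) (H : Hypergraph α) (ident : α → ℕ),
    H.vertexSet.Finite → H.vertexSet.ncard = n → H.maxDegree = Δ → H.rank = r →
    Set.InjOn ident H.vertexSet → (∀ v ∈ H.vertexSet, ident v ≤ n ^ c) →
    H.IsRulingSet a b (A.outputSet H ident T)

end LocalAlgorithm

/-! Everything takes place in the underlying graph, whose degree is at most Δ(r - 1). Linial's
reduction (`exists_reducesColors_sq`) turns the IDs into a proper colouring with O(D^2) colours in
O(log* n) rounds, where D is Δr times a constant depending on c.

If the colours are numerals with k digits in base B, then k * B rounds yield an independent set that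
dominates within distance k (`exists_rules_ruling`): digit by digit, lowest first, the classes that
agree in all higher digits are merged greedily, and each digit costs one unit of distance. For k ≥ 2
a base B = O(Δρ) with ρ^k ≥ r^2 accommodates O(Δ^2 r^2) colours. Taking ρ = 2 and k = 2⌈log₂ r⌉
proves the first claim. Taking ρ = ⌈r^(2/k)⌉ proves the second for k ≥ 2, because k r^(2/k) = O(k +
(2/3)^(k-1) r).

For k = 1 the base would be quadratic in Δr. There the additive-group reduction
(`ReducesColors.of_sq_prime`) first lowers the number of colours to O(Δr) in O(Δr) rounds, and the
colour classes are then treated one after the other. -/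

/-- One synchronous round of recolouring: the new colour of a vertex as a function of its colour and
of the set of the colours of its neighbours. -/
abbrev ColorRule := ℕ → Set ℕ → ℕ

namespace ColorRule

/-- The colouring after one round. -/
def apply {α : Type u} (f : ColorRule) (G : SimpleGraph α) (s : α → ℕ) : α → ℕ :=
  fun v => f (s v) (s '' G.neighborSet v)

/-- The colouring after a list of rounds. -/
def run {α : Type u} (G : SimpleGraph α) : List ColorRule → (α → ℕ) → α → ℕ
  | [], s => s
  | f :: fs, s => run G fs (f.apply G s)

theorem run_append {α : Type u} (G : SimpleGraph α) (fs gs : List ColorRule) (s : α → ℕ) :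
    run G (fs ++ gs) s = run G gs (run G fs s) := by
  induction fs generalizing s with
  | nil => rfl
  | cons f fs ih => exact ih _

theorem run_concat {α : Type u} (G : SimpleGraph α) (fs : List ColorRule) (f : ColorRule)
    (s : α → ℕ) : run G (fs ++ [f]) s = f.apply G (run G fs s) := by
  rw [run_append]; rfl

end ColorRule

open ColorRule

/-- A graph whose edges lie within `V` and whose degrees are at most `D`. -/
structure IsBoundedNetwork {α : Type u} (G : SimpleGraph α) (V : Set α) (D : ℕ) : Prop where
  left_mem : ∀ {u v}, G.Adj u v → u ∈ V
  finite_neighborSet : ∀ v, (G.neighborSet v).Finite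
  ncard_neighborSet_le : ∀ v, (G.neighborSet v).ncard ≤ D

theorem IsBoundedNetwork.right_mem {α : Type u} {G : SimpleGraph α} {V : Set α} {D : ℕ}
    (h : IsBoundedNetwork G V D) {u v : α} (huv : G.Adj u v) : v ∈ V :=
  h.left_mem huv.symm

/-- A proper colouring of the vertices in `V` with colours below `m`. -/
structure IsProperColoring {α : Type u} (G : SimpleGraph α) (V : Set α) (m : ℕ) (s : α → ℕ) :
    Prop where
  lt : ∀ v ∈ V, s v < m
  ne : ∀ {u v}, G.Adj u v → s u ≠ s v

theorem IsProperColoring.mono {α : Type u} {G : SimpleGraph α} {V : Set α} {m m' : ℕ} {s : α → ℕ}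
    (h : IsProperColoring G V m s) (hm : m ≤ m') : IsProperColoring G V m' s :=
  ⟨fun v hv => (h.lt v hv).trans_le hm, h.ne⟩

/-- In `T` rounds every proper colouring with `m` colours of a graph of degree at most `D` can be
turned into one with `m'` colours. -/
def ReducesColors (D m m' T : ℕ) : Prop :=
  ∃ fs : List ColorRule, fs.length ≤ T ∧
    ∀ (α : Type u) (G : SimpleGraph α) (V : Set α) (s : α → ℕ),
      IsBoundedNetwork G V D → IsProperColoring G V m s → IsProperColoring G V m' (run G fs s)

namespace ReducesColors

theorem of_le {D m m' : ℕ} (h : m ≤ m') (T : ℕ) : ReducesColors.{u} D m m' T :=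
  ⟨[], Nat.zero_le _, fun _ _ _ _ _ hs => hs.mono h⟩

theorem trans {D m₁ m₂ m₃ T₁ T₂ : ℕ} (h₁ : ReducesColors.{u} D m₁ m₂ T₁)
    (h₂ : ReducesColors.{u} D m₂ m₃ T₂) : ReducesColors.{u} D m₁ m₃ (T₁ + T₂) := by
  obtain ⟨fs, hfs, hf⟩ := h₁
  obtain ⟨gs, hgs, hg⟩ := h₂
  refine ⟨fs ++ gs, by rw [List.length_append]; omega, fun α G V s hG hs => ?_⟩
  rw [run_append]
  exact hg _ _ _ _ hG (hf _ _ _ _ hG hs)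

theorem mono {D m₁ m₂ m₁' m₂' T T' : ℕ} (h : ReducesColors.{u} D m₁ m₂ T) (h₁ : m₁' ≤ m₁)
    (h₂ : m₂ ≤ m₂') (hT : T ≤ T') : ReducesColors.{u} D m₁' m₂' T' := by
  obtain ⟨fs, hfs, hf⟩ := h
  exact ⟨fs, hfs.trans hT, fun α G V s hG hs => (hf _ _ _ _ hG (hs.mono h₁)).mono h₂⟩

end ReducesColors

/-! ### Linial's one-round colour reduction -/

/-- There are `q ^ (d + 1)` functions on the field with `q` elements, any two of which agree in at
most `d` points, namely the polynomials of degree at most `d`. -/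
theorem exists_functions_card_agree_le (q d : ℕ) [Fact q.Prime] :
    ∃ P : ℕ → ZMod q → ZMod q, ∀ x y, x < q ^ (d + 1) → y < q ^ (d + 1) → x ≠ y →
      (Finset.univ.filter fun i => P x i = P y i).card ≤ d := by
  classical
  have e : Fin (q ^ (d + 1)) ≃ Polynomial.degreeLT (ZMod q) (d + 1) :=
    (Fintype.equivFinOfCardEq (by simp [ZMod.card])).symm.trans
      (Polynomial.degreeLTEquiv (ZMod q) (d + 1)).toEquiv.symm
  refine ⟨fun x i => if h : x < q ^ (d + 1) then
    (e ⟨x, h⟩ : Polynomial (ZMod q)).eval i else 0, fun x y hx hy hxy => ?_⟩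
  simp only [hx, hy, dif_pos]
  set a := e ⟨x, hx⟩
  set b := e ⟨y, hy⟩
  have hab : (a : Polynomial (ZMod q)) - b ≠ 0 := by
    rw [sub_ne_zero]
    intro h
    have := e.injective (Subtype.ext h)
    simp at this
    exact hxy this
  have hdeg : ((a : Polynomial (ZMod q)) - b).natDegree ≤ d := by
    have := Polynomial.mem_degreeLT.1 (a - b).2
    rw [Submodule.coe_sub] at this
    have h2 := (Polynomial.natDegree_lt_iff_degree_lt hab).2 this
    omega
  refine le_trans ?_ ((Polynomial.card_roots' _).trans hdeg)
  refine le_trans (Finset.card_le_card (t := ((a : Polynomial (ZMod q)) - b).roots.toFinset) ?_)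
    (Multiset.toFinset_card_le _)
  intro i hi
  simp only [Finset.mem_filter, Finset.mem_univ, true_and] at hi
  simp [hab, hi]

/-- One round of Linial's colour reduction. -/
theorem ReducesColors.of_prime {D m q d : ℕ} (hq : q.Prime) (hd : D * d < q)
    (hm : m ≤ q ^ (d + 1)) : ReducesColors.{u} D m (q ^ 2) 1 := by
  classical
  have : Fact q.Prime := ⟨hq⟩
  obtain ⟨P, hP⟩ := exists_functions_card_agree_le q d
  -- The new colour encodes a point `i` and the value of the polynomial `P x` there. Each of the at
  -- most `D` neighbours spoils at most `d` points and `D * d < q`, so some point is good and the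
  -- default `0` never occurs on `V`.
  let f : ColorRule := fun x N =>
    if h : ∃ i : ZMod q, ∀ y ∈ N, P x i ≠ P y i then h.choose.val * q + (P x h.choose).val else 0
  refine ⟨[f], le_rfl, fun α G V s hG hs => ?_⟩
  have hlt : ∀ i j : ZMod q, i.val * q + j.val < q ^ 2 := fun i j => by
    have := ZMod.val_lt i
    have := ZMod.val_lt j
    nlinarith
  have key : ∀ v ∈ V, ∃ i : ZMod q, (∀ w, G.Adj v w → P (s v) i ≠ P (s w) i) ∧
      f.apply G s v = i.val * q + (P (s v) i).val := by
    intro v hv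
    have hex : ∃ i : ZMod q, ∀ y ∈ s '' G.neighborSet v, P (s v) i ≠ P y i := by
      by_contra! hcon
      have hsub : (Finset.univ : Finset (ZMod q)) ⊆ (hG.finite_neighborSet v).toFinset.biUnion
          fun w => Finset.univ.filter fun i => P (s v) i = P (s w) i := by
        intro i _
        obtain ⟨y, ⟨w, hw, rfl⟩, hi⟩ := hcon i
        simp only [Finset.mem_biUnion, Set.Finite.mem_toFinset, Finset.mem_filter,
          Finset.mem_univ, true_and]
        exact ⟨w, hw, hi⟩
      have h1 := Finset.card_le_card hsub
      have h2 := Finset.card_biUnion_le_card_mul (hG.finite_neighborSet v).toFinset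
        (fun w => Finset.univ.filter fun i => P (s v) i = P (s w) i) d (fun w hw => by
          have hw' : G.Adj v w := by simpa using hw
          exact hP _ _ ((hs.lt v hv).trans_le hm) ((hs.lt w (hG.right_mem hw')).trans_le hm)
            (hs.ne hw'))
      rw [← Set.ncard_eq_toFinset_card _ (hG.finite_neighborSet v)] at h2
      rw [Finset.card_univ, ZMod.card] at h1
      have := Nat.mul_le_mul_right d (hG.ncard_neighborSet_le v)
      omega
    refine ⟨hex.choose, fun w hw => hex.choose_spec _ ⟨w, hw, rfl⟩, ?_⟩
    simp only [ColorRule.apply, f]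
    rw [dif_pos hex]
  constructor
  · intro v hv
    obtain ⟨i, -, hi⟩ := key v hv
    change f.apply G s v < q ^ 2
    exact hi.trans_lt (hlt _ _)
  · intro u v huv heq
    obtain ⟨i, hi, hiu⟩ := key u (hG.left_mem huv)
    obtain ⟨j, -, hjv⟩ := key v (hG.right_mem huv)
    change f.apply G s u = f.apply G s v at heq
    rw [hiu, hjv] at heq
    have h1 := congrArg (· / q) heq
    have h2 := congrArg (· % q) heq
    simp only [mul_comm _ q, Nat.mul_add_div hq.pos, Nat.mul_add_mod,
      Nat.div_eq_of_lt (ZMod.val_lt _), Nat.mod_eq_of_lt (ZMod.val_lt _), add_zero] at h1 h2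
    obtain rfl := ZMod.val_injective q h1
    exact hi v huv (ZMod.val_injective q h2)

/-! ### Ruling sets from colour digits -/

/-- A stage of the computation of a ruling set from a proper colouring with `B ^ k` colours, which
treats the colours as numerals in base `B`: level `j` merges, for every value of the higher digits,
the classes that differ in the digit with index `j`, and `i` values of this digit have been treated.
The vertices with colours below `B ^ k` are active. -/
structure IsRulingStage {α : Type u} (G : SimpleGraph α) (V : Set α) (B k j i : ℕ) (s : α → ℕ) :
    Prop where
  not_adj : ∀ u v, G.Adj u v → s u < B ^ k → s v < B ^ k →
    s u / B ^ (j + 1) = s v / B ^ (j + 1) →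
    (s u / B ^ j % B = s v / B ^ j % B ∨ (s u / B ^ j % B < i ∧ s v / B ^ j % B < i)) → False
  exists_near : ∀ v ∈ V, ∃ u ∈ V, s u < B ^ k ∧
    (G.edist v u ≤ (j : ℕ∞) ∨ (G.edist v u ≤ ((j + 1 : ℕ) : ℕ∞) ∧ s u / B ^ j % B < i))

open Classical in
/-- The round of the computation of a ruling set that treats the value `i` of digit `j`. -/
noncomputable def rulingRule (B k j i : ℕ) : ColorRule := fun x N =>
  -- The value `B ^ k` is not a valid colour and marks a vertex that has withdrawn.
  if x / B ^ j % B = i ∧ ∃ y ∈ N, y < B ^ k ∧ y / B ^ (j + 1) = x / B ^ (j + 1) ∧ y / B ^ j % B < i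
  then B ^ k else x

theorem rulingRule_lt_iff {B k j i x : ℕ} {N : Set ℕ} : rulingRule B k j i x N < B ^ k ↔
    x < B ^ k ∧ ¬ (x / B ^ j % B = i ∧
      ∃ y ∈ N, y < B ^ k ∧ y / B ^ (j + 1) = x / B ^ (j + 1) ∧ y / B ^ j % B < i) := by
  unfold rulingRule
  split_ifs with h <;> simp [h]

theorem rulingRule_eq_of_lt {B k j i x : ℕ} {N : Set ℕ} (h : rulingRule B k j i x N < B ^ k) :
    rulingRule B k j i x N = x :=
  if_neg (rulingRule_lt_iff.1 h).2

/-- Active vertices with the same higher digits and digit `i` are not adjacent, so they can decide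
simultaneously. One that withdraws has an active neighbour with a smaller digit, which stays. A
vertex lost in this round was still a witness at distance `j`, so its replacement is within `j + 1`,
and its digit, already treated, prevents a second loss at this level. -/
theorem IsRulingStage.apply {α : Type u} {G : SimpleGraph α} {V : Set α} {B k j i D : ℕ}
    {s : α → ℕ} (hG : IsBoundedNetwork G V D) (h : IsRulingStage G V B k j i s) :
    IsRulingStage G V B k j (i + 1) ((rulingRule B k j i).apply G s) := by
  set t := (rulingRule B k j i).apply G s with ht
  have hlt : ∀ v, t v < B ^ k ↔ s v < B ^ k ∧ ¬ (s v / B ^ j % B = i ∧ ∃ w, G.Adj v w ∧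
      s w < B ^ k ∧ s w / B ^ (j + 1) = s v / B ^ (j + 1) ∧ s w / B ^ j % B < i) := by
    intro v
    simp only [ht, ColorRule.apply, rulingRule_lt_iff, Set.exists_mem_image,
      SimpleGraph.mem_neighborSet]
  have heq : ∀ v, t v < B ^ k → t v = s v := fun v hv => rulingRule_eq_of_lt hv
  constructor
  · intro u v huv hu hv
    rw [heq u hu, heq v hv]
    have hu' := (hlt u).1 hu
    have hv' := (hlt v).1 hv
    intro hgroup hdig
    by_cases hs : s u / B ^ j % B = s v / B ^ j % B
    · exact h.not_adj u v huv hu'.1 hv'.1 hgroup (.inl hs)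
    obtain ⟨h1, h2⟩ := hdig.resolve_left hs
    by_cases hui : s u / B ^ j % B = i
    · exact hu'.2 ⟨hui, v, huv, hv'.1, hgroup.symm, by omega⟩
    by_cases hvi : s v / B ^ j % B = i
    · exact hv'.2 ⟨hvi, u, huv.symm, hu'.1, hgroup, by omega⟩
    exact h.not_adj u v huv hu'.1 hv'.1 hgroup (.inr (by omega))
  · intro v hv
    obtain ⟨u, huV, hu, hd⟩ := h.exists_near v hv
    by_cases hut : t u < B ^ k
    · refine ⟨u, huV, hut, ?_⟩
      rw [heq u hut]
      exact hd.imp_right fun h => ⟨h.1, h.2.trans i.lt_succ_self⟩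
    · rw [hlt, not_and_not_right] at hut
      obtain ⟨hi, w, huw, hw, -, hwi⟩ := hut hu
      have hwt : t w < B ^ k := (hlt w).2 ⟨hw, fun h => by omega⟩
      refine ⟨w, hG.right_mem huw, hwt, .inr ⟨?_, by rw [heq w hwt]; omega⟩⟩
      have hvu : G.edist v u ≤ (j : ℕ∞) := hd.resolve_right fun h => by omega
      calc G.edist v w ≤ G.edist v u + G.edist u w := SimpleGraph.edist_triangle
        _ ≤ j + 1 := add_le_add hvu (SimpleGraph.edist_eq_one_iff_adj.2 huw).le
        _ = _ := by push_cast; rfl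

theorem IsRulingStage.succ {α : Type u} {G : SimpleGraph α} {V : Set α} {B k j : ℕ}
    {s : α → ℕ} (hB : 0 < B) (h : IsRulingStage G V B k j B s) :
    IsRulingStage G V B k (j + 1) 0 s := by
  constructor
  · intro u v huv hu hv hgroup hdig
    refine h.not_adj u v huv hu hv ?_ (.inr ⟨Nat.mod_lt _ hB, Nat.mod_lt _ hB⟩)
    -- Agreeing in digit `j + 1` and all higher ones means being in the same group of level `j`,
    -- where every digit is below `B` and hence treated.
    rw [pow_succ _ (j + 1), ← Nat.div_div_eq_div_mul, ← Nat.div_div_eq_div_mul] at hgroup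
    rw [← Nat.div_add_mod (s u / B ^ (j + 1)) B, ← Nat.div_add_mod (s v / B ^ (j + 1)) B, hgroup,
      hdig.resolve_right (by simp)]
  · intro v hv
    obtain ⟨u, huV, hu, hd⟩ := h.exists_near v hv
    refine ⟨u, huV, hu, .inl ?_⟩
    rcases hd with hd | hd
    · exact hd.trans (by exact_mod_cast j.le_succ)
    · exact hd.1

/-- From a proper colouring with `B ^ k` colours, `k * B` rounds compute an independent set that
dominates all vertices within distance `k`. -/
theorem exists_rules_ruling (B k D : ℕ) (hB : 0 < B) :
    ∃ fs : List ColorRule, fs.length = k * B ∧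
      ∀ (α : Type u) (G : SimpleGraph α) (V : Set α) (s : α → ℕ),
        IsBoundedNetwork G V D → IsProperColoring G V (B ^ k) s →
        (∀ u v, run G fs s u < B ^ k → run G fs s v < B ^ k → ¬ G.Adj u v) ∧
        ∀ v ∈ V, ∃ u ∈ V, run G fs s u < B ^ k ∧ G.edist v u ≤ (k : ℕ∞) := by
  have inner : ∀ j i : ℕ, ∃ fs : List ColorRule, fs.length = i ∧
      ∀ (α : Type u) (G : SimpleGraph α) (V : Set α) (s : α → ℕ),
        IsBoundedNetwork G V D → IsRulingStage G V B k j 0 s →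
        IsRulingStage G V B k j i (run G fs s) := by
    intro j i
    induction i with
    | zero => exact ⟨[], rfl, fun _ _ _ _ _ h => h⟩
    | succ i ih =>
      obtain ⟨fs, hl, hfs⟩ := ih
      refine ⟨fs ++ [rulingRule B k j i], by simp [hl], fun α G V s hG hs => ?_⟩
      rw [run_concat]
      exact (hfs α G V s hG hs).apply hG
  have outer : ∀ j : ℕ, ∃ fs : List ColorRule, fs.length = j * B ∧
      ∀ (α : Type u) (G : SimpleGraph α) (V : Set α) (s : α → ℕ),
        IsBoundedNetwork G V D → IsRulingStage G V B k 0 0 s →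
        IsRulingStage G V B k j 0 (run G fs s) := by
    intro j
    induction j with
    | zero => exact ⟨[], by simp, fun _ _ _ _ _ h => h⟩
    | succ j ih =>
      obtain ⟨fs, hl, hfs⟩ := ih
      obtain ⟨gs, hl', hgs⟩ := inner j B
      refine ⟨fs ++ gs, by simp [hl, hl', Nat.succ_mul], fun α G V s hG hs => ?_⟩
      rw [run_append]
      exact (hgs α G V _ hG (hfs α G V s hG hs)).succ hB
  obtain ⟨fs, hl, hfs⟩ := outer k
  refine ⟨fs, hl, fun α G V s hG hs => ?_⟩
  have hstart : IsRulingStage G V B k 0 0 s := by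
    constructor
    · intro u v huv _ _ hgroup hdig
      have hdig := hdig.resolve_right (by simp)
      simp only [zero_add, pow_one, pow_zero, Nat.div_one] at hgroup hdig
      exact hs.ne huv (by rw [← Nat.div_add_mod (s u) B, hgroup, hdig, Nat.div_add_mod])
    · exact fun v hv => ⟨v, hv, hs.lt v hv, .inl (by simp)⟩
  have hend := hfs α G V s hG hstart
  constructor
  · intro u v hu hv huv
    -- Active colours have no digits from index `k` on, so all active vertices lie in one class.
    have hpow : B ^ k ≤ B ^ (k + 1) := Nat.pow_le_pow_right hB k.le_succ
    refine hend.not_adj u v huv hu hv ?_ (.inl ?_)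
    · rw [Nat.div_eq_of_lt (hu.trans_le hpow), Nat.div_eq_of_lt (hv.trans_le hpow)]
    · rw [Nat.div_eq_of_lt hu, Nat.div_eq_of_lt hv]
  · intro v hv
    obtain ⟨u, huV, hu, hd⟩ := hend.exists_near v hv
    exact ⟨u, huV, hu, hd.resolve_right (by simp)⟩

/-! ### Iterating Linial's reduction -/

theorem logStar_of_one_lt {n : ℕ} (h : 1 < n) : logStar n = logStar (Nat.clog 2 n) + 1 := by
  rw [logStar, dif_neg (by omega)]

theorem clog_two_lt_self {n : ℕ} (h : 1 < n) : Nat.clog 2 n < n := by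
  refine lt_of_le_of_lt (b := n - 1) (Nat.clog_le_of_le_pow ?_) (by omega)
  have := Nat.lt_two_pow_self (n := n - 1)
  omega

theorem logStar_two_pow_le (n : ℕ) : logStar (2 ^ n) ≤ logStar n + 1 := by
  rcases Nat.eq_zero_or_pos n with rfl | hn
  · rw [pow_zero, logStar, dif_pos le_rfl]
    exact Nat.zero_le _
  · rw [logStar_of_one_lt (Nat.one_lt_two_pow hn.ne'), Nat.clog_pow 2 n one_lt_two]

theorem four_mul_pow_four_le_two_pow {l : ℕ} (hl : 40 ≤ l) :
    4 * (4 * l + 2) ^ 4 ≤ 2 ^ (l - 1) := by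
  obtain ⟨n, rfl⟩ := Nat.exists_eq_add_of_le hl
  rw [show 40 + n - 1 = n + 39 by omega]
  clear hl
  induction n with
  | zero => norm_num
  | succ n ih =>
    rw [show n + 1 + 39 = n + 39 + 1 by omega, pow_succ 2]
    -- The base grows by a factor of at most 9/8, and (9/8)^4 < 2.
    have h : (4 * (40 + (n + 1)) + 2) ^ 4 ≤ 2 * (4 * (40 + n) + 2) ^ 4 := by
      have h2 : 8 * (4 * (40 + (n + 1)) + 2) ≤ 9 * (4 * (40 + n) + 2) := by omega
      have := Nat.pow_le_pow_left h2 4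
      rw [mul_pow, mul_pow] at this
      omega
    omega

/-- With `L = Nat.clog 2 m`, two Linial rounds lead from `m` colours to at most `L`, so they pay for
one step of log*. -/
theorem four_mul_clog_pow_four_le {L : ℕ} (hL : 2 ^ 40 < L) :
    4 * Nat.clog 2 (4 * L ^ 4) ^ 4 ≤ L := by
  have h1 : Nat.clog 2 (4 * L ^ 4) ≤ 4 * Nat.clog 2 L + 2 := by
    refine Nat.clog_le_of_le_pow ?_
    have := Nat.pow_le_pow_left (Nat.le_pow_clog one_lt_two L) 4
    rw [← pow_mul, mul_comm _ 4] at this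
    rw [pow_add]
    omega
  have h2 : 40 ≤ Nat.clog 2 L := ((Nat.lt_clog_iff_pow_lt one_lt_two).2 hL).le
  have h3 := Nat.pow_pred_clog_lt_self one_lt_two (x := L) (lt_trans (by norm_num) hL)
  calc 4 * Nat.clog 2 (4 * L ^ 4) ^ 4 ≤ 4 * (4 * Nat.clog 2 L + 2) ^ 4 := by gcongr
    _ ≤ _ := four_mul_pow_four_le_two_pow h2
    _ ≤ L := h3.le

namespace ReducesColors

/-- Polynomials of degree at most `L` over a field of prime size `q` between `L ^ 2` and `2 * L ^
2`: the hypothesis gives `D < L`, hence `D * L < q`. -/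
theorem clog_pow_four {D m : ℕ} (hm : 2 ^ D < m) :
    ReducesColors.{u} D m (4 * Nat.clog 2 m ^ 4) 1 := by
  have hDL : D < Nat.clog 2 m := (Nat.lt_clog_iff_pow_lt one_lt_two).2 hm
  set L := Nat.clog 2 m
  have hL : 0 < L := by omega
  obtain ⟨q, hq, hLq, hqL⟩ := Nat.exists_prime_lt_and_le_two_mul (L ^ 2) (by positivity)
  have hpow : m ≤ q ^ (L + 1) :=
    calc m ≤ 2 ^ L := Nat.le_pow_clog one_lt_two m
      _ ≤ q ^ L := Nat.pow_le_pow_left hq.two_le L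
      _ ≤ q ^ (L + 1) := Nat.pow_le_pow_right hq.pos L.le_succ
  refine (of_prime hq (d := L) (by nlinarith) hpow).mono le_rfl ?_ le_rfl
  calc q ^ 2 ≤ (2 * L ^ 2) ^ 2 := Nat.pow_le_pow_left hqL 2
    _ = _ := by ring

theorem two_pow {D : ℕ} (hD : 2 ^ 40 ≤ D) (m : ℕ) :
    ReducesColors.{u} D m (2 ^ D) (2 * logStar m) := by
  induction m using Nat.strong_induction_on with
  | _ m ih =>
    by_cases hm : m ≤ 2 ^ D
    · exact of_le hm _
    push Not at hm
    have hm1 : 1 < m := lt_of_le_of_lt Nat.one_le_two_pow hm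
    rw [logStar_of_one_lt hm1]
    have h1 := clog_pow_four.{u} hm
    have hDL : D < Nat.clog 2 m := (Nat.lt_clog_iff_pow_lt one_lt_two).2 hm
    by_cases hm2 : 4 * Nat.clog 2 m ^ 4 ≤ 2 ^ D
    · exact h1.mono le_rfl hm2 (by omega)
    push Not at hm2
    have h2 := (clog_pow_four.{u} hm2).mono le_rfl
      (four_mul_clog_pow_four_le (hD.trans_lt hDL)) le_rfl
    exact ((h1.trans h2).trans (ih _ (clog_two_lt_self hm1))).mono le_rfl le_rfl (by omega)

/-- Degree `D` with `q` about `D ^ 2` leaves `O(D ^ 4)` colours; for these degree 4 suffices, with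
`q` about `4 * D`. -/
theorem sq_of_two_pow {D : ℕ} (hD : 0 < D) : ReducesColors.{u} D (2 ^ D) (64 * D ^ 2) 2 := by
  have h1 : ReducesColors.{u} D (2 ^ D) (4 * D ^ 4) 1 := by
    obtain ⟨q, hq, hDq, hqD⟩ := Nat.exists_prime_lt_and_le_two_mul (D ^ 2) (by positivity)
    have hpow : 2 ^ D ≤ q ^ (D + 1) :=
      calc 2 ^ D ≤ q ^ D := Nat.pow_le_pow_left hq.two_le D
        _ ≤ q ^ (D + 1) := Nat.pow_le_pow_right hq.pos D.le_succ
    refine (of_prime hq (d := D) (by nlinarith) hpow).mono le_rfl ?_ le_rfl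
    calc q ^ 2 ≤ (2 * D ^ 2) ^ 2 := Nat.pow_le_pow_left hqD 2
      _ = _ := by ring
  have h2 : ReducesColors.{u} D (4 * D ^ 4) (64 * D ^ 2) 1 := by
    obtain ⟨q, hq, hDq, hqD⟩ := Nat.exists_prime_lt_and_le_two_mul (4 * D) (by positivity)
    have hpow : 4 * D ^ 4 ≤ q ^ (4 + 1) :=
      calc 4 * D ^ 4 ≤ 4 * D ^ 4 * (256 * D) := Nat.le_mul_of_pos_right _ (by positivity)
        _ = (4 * D) ^ 5 := by ring
        _ ≤ q ^ 5 := Nat.pow_le_pow_left hDq.le 5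
    refine (of_prime hq (d := 4) (by omega) hpow).mono le_rfl ?_ le_rfl
    calc q ^ 2 ≤ (2 * (4 * D)) ^ 2 := Nat.pow_le_pow_left hqD 2
      _ = _ := by ring
  exact h1.trans h2

end ReducesColors

theorem exists_pow_add_one_le_two_pow (c : ℕ) : ∃ K : ℕ, ∀ n, K ≤ n → n ^ c + 1 ≤ 2 ^ n := by
  have h := (tendsto_pow_const_div_const_pow_of_one_lt c (one_lt_two (α := ℝ))).eventually
    (gt_mem_nhds one_pos)
  obtain ⟨K, hK⟩ := Filter.eventually_atTop.1 h
  refine ⟨K, fun n hn => ?_⟩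
  have := hK n hn
  rw [div_lt_one (by positivity)] at this
  exact_mod_cast this

/-- Linial's colouring algorithm, starting from IDs of polynomial size. -/
theorem exists_reducesColors_sq (c : ℕ) : ∃ K : ℕ, 0 < K ∧ ∀ n D : ℕ, K ≤ D →
    ReducesColors.{u} D (n ^ c + 1) (64 * D ^ 2) (2 * logStar n + 4) := by
  obtain ⟨K, hK⟩ := exists_pow_add_one_le_two_pow c
  -- The summand `K ^ c + 1` handles `n ≤ K`, where the IDs are already colours below `2 ^ D`. For
  -- larger `n` they are below `2 ^ n`, which raises log* by at most one.
  refine ⟨2 ^ 40 + (K ^ c + 1), by positivity, fun n D hD => ?_⟩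
  have hfin := ReducesColors.sq_of_two_pow.{u} (D := D) (by omega)
  rcases le_total K n with hn | hn
  · have h := ReducesColors.two_pow.{u} (D := D) (by omega) (2 ^ n)
    have := logStar_two_pow_le n
    exact (h.trans hfin).mono (hK n hn) le_rfl (by omega)
  · refine hfin.mono ?_ le_rfl (by omega)
    have := Nat.pow_le_pow_left hn c
    have := Nat.lt_two_pow_self (n := D)
    omega

/-! ### The additive-group colour reduction -/

open Classical in
/-- A round of the additive-group colour reduction: a colour `a * q + b` with `a, b < q` advances
its lower part `b` by `a` while it agrees with that of a neighbour, and becomes `b` otherwise. -/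
noncomputable def additiveRule (q : ℕ) : ColorRule := fun x N =>
  if ∃ y ∈ N, y % q = x % q then x / q * q + (x % q + x / q) % q else x % q

section additiveRule

variable {α : Type u} {G : SimpleGraph α} {s : α → ℕ} {q : ℕ} {v : α}

theorem additiveRule_apply_div_of_conflict (hq : 0 < q) (h : ∃ w, G.Adj v w ∧ s w % q = s v % q) :
    (additiveRule q).apply G s v / q = s v / q := by
  obtain ⟨w, hw, h⟩ := h
  rw [ColorRule.apply, additiveRule, if_pos ⟨_, ⟨w, hw, rfl⟩, h⟩, mul_comm,
    Nat.mul_add_div hq, Nat.div_eq_of_lt (Nat.mod_lt _ hq), add_zero]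

theorem additiveRule_apply_mod_of_conflict (h : ∃ w, G.Adj v w ∧ s w % q = s v % q) :
    (additiveRule q).apply G s v % q = (s v % q + s v / q) % q := by
  obtain ⟨w, hw, h⟩ := h
  rw [ColorRule.apply, additiveRule, if_pos ⟨_, ⟨w, hw, rfl⟩, h⟩, mul_comm,
    Nat.mul_add_mod, Nat.mod_mod]

theorem additiveRule_apply_of_not_conflict (h : ¬ ∃ w, G.Adj v w ∧ s w % q = s v % q) :
    (additiveRule q).apply G s v = s v % q := by
  rw [ColorRule.apply, additiveRule, if_neg]
  rintro ⟨_, ⟨w, hw, rfl⟩, hc⟩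
  exact h ⟨w, hw, hc⟩

/-- Two conflicting vertices with equal new colours have equal upper parts, so they made the same
shift and had equal colours before. If only one is in conflict, equality forces its upper part and
hence its shift to be 0, so the other was in conflict with it. -/
theorem additiveRule_apply_ne (hq : 0 < q) (hs : ∀ {u v}, G.Adj u v → s u ≠ s v) {u v : α}
    (huv : G.Adj u v) : (additiveRule q).apply G s u ≠ (additiveRule q).apply G s v := by
  have main : ∀ {u v : α}, G.Adj u v → (∃ w, G.Adj u w ∧ s w % q = s u % q) →
      (¬ ∃ w, G.Adj v w ∧ s w % q = s v % q) →
      (additiveRule q).apply G s u ≠ (additiveRule q).apply G s v := by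
    intro u v huv hu hv heq
    have h1 := congrArg (· / q) heq
    have h2 := congrArg (· % q) heq
    simp only [additiveRule_apply_div_of_conflict hq hu, additiveRule_apply_mod_of_conflict hu,
      additiveRule_apply_of_not_conflict hv, Nat.div_eq_of_lt (Nat.mod_lt (s v) hq)] at h1 h2
    rw [h1, add_zero, Nat.mod_mod, Nat.mod_mod] at h2
    exact hv ⟨u, huv.symm, h2⟩
  by_cases hu : ∃ w, G.Adj u w ∧ s w % q = s u % q <;>
    by_cases hv : ∃ w, G.Adj v w ∧ s w % q = s v % q
  · intro heq
    have h1 := congrArg (· / q) heq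
    have h2 := congrArg (· % q) heq
    simp only [additiveRule_apply_div_of_conflict hq hu, additiveRule_apply_mod_of_conflict hu,
      additiveRule_apply_div_of_conflict hq hv, additiveRule_apply_mod_of_conflict hv] at h1 h2
    rw [h1] at h2
    have h3 : s u % q = s v % q := by
      have := Nat.ModEq.add_right_cancel' _ h2
      rwa [Nat.ModEq, Nat.mod_mod, Nat.mod_mod] at this
    exact hs huv (by rw [← Nat.div_add_mod (s u) q, h1, h3, Nat.div_add_mod])
  · exact main huv hu hv
  · exact (main huv.symm hv hu).symm
  · rw [additiveRule_apply_of_not_conflict hu, additiveRule_apply_of_not_conflict hv]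
    exact fun h => hu ⟨v, huv, h.symm⟩

end additiveRule

section additiveRun

variable {α : Type u} {G : SimpleGraph α} {S : ℕ → α → ℕ} {q : ℕ}

theorem additive_frozen (hq : 0 < q) (hS : ∀ t, S (t + 1) = (additiveRule q).apply G (S t)) {v : α}
    {t : ℕ} (h : S t v / q = 0) {t' : ℕ} (ht : t ≤ t') : S t' v / q = 0 ∧ S t' v % q = S t v % q := by
  induction t', ht using Nat.le_induction with
  | base => exact ⟨h, rfl⟩
  | succ t' _ ih =>
    rw [hS]
    by_cases hc : ∃ w, G.Adj v w ∧ S t' w % q = S t' v % q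
    · rw [additiveRule_apply_div_of_conflict hq hc, additiveRule_apply_mod_of_conflict hc, ih.1,
        add_zero, Nat.mod_mod]
      exact ⟨rfl, ih.2⟩
    · rw [additiveRule_apply_of_not_conflict hc, Nat.mod_mod]
      exact ⟨Nat.div_eq_of_lt (Nat.mod_lt _ hq), ih.2⟩

/-- A nonzero upper part survives only a conflict, so the vertex has moved in every round, at
constant speed modulo `q`. The cast to `ZMod q` sees just the lower part. -/
theorem additive_moving (hq : 0 < q) (hS : ∀ t, S (t + 1) = (additiveRule q).apply G (S t)) {v : α}
    {t : ℕ} (h : S t v / q ≠ 0) : S t v / q = S 0 v / q ∧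
      ((S t v : ℕ) : ZMod q) = (S 0 v : ℕ) + t * ((S 0 v / q : ℕ) : ZMod q) := by
  induction t with
  | zero => simp
  | succ t ih =>
    rw [hS] at h ⊢
    by_cases hc : ∃ w, G.Adj v w ∧ S t w % q = S t v % q
    · rw [additiveRule_apply_div_of_conflict hq hc] at h ⊢
      obtain ⟨h1, h2⟩ := ih h
      refine ⟨h1, ?_⟩
      rw [← ZMod.natCast_mod ((additiveRule q).apply G (S t) v),
        additiveRule_apply_mod_of_conflict hc, ZMod.natCast_mod, Nat.cast_add, ZMod.natCast_mod,
        h2, h1]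
      push_cast
      ring
    · rw [additiveRule_apply_of_not_conflict hc] at h
      exact absurd (Nat.div_eq_of_lt (Nat.mod_lt _ hq)) h

theorem natCast_zmod_injOn {t t' : ℕ} (ht : t < q) (ht' : t' < q)
    (h : (t : ZMod q) = (t' : ZMod q)) : t = t' := by
  rwa [ZMod.natCast_eq_natCast_iff', Nat.mod_eq_of_lt ht, Nat.mod_eq_of_lt ht'] at h

/-- A vertex that never stops is in conflict in each of `q` rounds. A given neighbour causes at most
one conflict while it moves and one after it has stopped, so `q ≤ 2 * D`, a contradiction. -/
theorem additive_finished (hq : q.Prime) {V : Set α} {D : ℕ} (hG : IsBoundedNetwork G V D)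
    (hD : 2 * D < q) (hS : ∀ t, S (t + 1) = (additiveRule q).apply G (S t))
    (h0 : IsProperColoring G V (q ^ 2) (S 0)) {v : α} (hv : v ∈ V) : S q v / q = 0 := by
  classical
  have : Fact q.Prime := ⟨hq⟩
  have hlt : ∀ w ∈ V, S 0 w / q < q := fun w hw =>
    Nat.div_lt_of_lt_mul (by rw [← sq]; exact h0.lt w hw)
  by_contra hcon
  have hne : ∀ t ≤ q, S t v / q ≠ 0 := fun t ht h => hcon (additive_frozen hq.pos hS h ht).1
  have hconf : ∀ t < q, ∃ w, G.Adj v w ∧ S t w % q = S t v % q := by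
    intro t ht
    by_contra hc
    refine hne (t + 1) ht ?_
    rw [hS, additiveRule_apply_of_not_conflict hc]
    exact Nat.div_eq_of_lt (Nat.mod_lt _ hq.pos)
  have : Nonempty α := ⟨v⟩
  choose! w hw using hconf
  have ha : ((S 0 v / q : ℕ) : ZMod q) ≠ 0 := by
    intro h
    exact hne 0 (Nat.zero_le _) (natCast_zmod_injOn (hlt v hv) hq.pos (h.trans Nat.cast_zero.symm))
  have hcard := Finset.card_le_card_of_injOn (s := Finset.range q)
    (t := (hG.finite_neighborSet v).toFinset ×ˢ (Finset.univ : Finset Bool))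
    (fun t => (w t, decide (S t (w t) / q = 0)))
    (fun t ht => by
      have := (hw t (by simpa using ht)).1
      rw [Finset.mem_coe, Finset.mem_product]
      exact ⟨(Set.Finite.mem_toFinset _).2 this, Finset.mem_univ _⟩)
    (by
      intro t ht t' ht' heq
      simp only [Finset.coe_range, Set.mem_Iio] at ht ht'
      simp only [Prod.mk.injEq, decide_eq_decide] at heq
      obtain ⟨hww, hflag⟩ := heq
      have hcast : ∀ t < q, ((S t (w t) : ℕ) : ZMod q) =
          (S 0 v : ℕ) + t * ((S 0 v / q : ℕ) : ZMod q) := fun t ht => by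
        rw [← (additive_moving hq.pos hS (hne t ht.le)).2, ZMod.natCast_eq_natCast_iff']
        exact (hw t ht).2
      have h1 := hcast t ht
      have h2 := hcast t' ht'
      have hadj := (hw t ht).1
      rw [← hww] at h2 hflag
      generalize w t = y at h1 h2 hflag hadj
      -- A stopped neighbour holds one residue, and `v`, moving at nonzero speed, meets it once in
      -- `q` rounds. Against a moving neighbour, two meetings force equal speeds and then equal
      -- initial colours.
      by_cases hz : S t y / q = 0
      · have hyy : ((S t y : ℕ) : ZMod q) = (S t' y : ℕ) := by
          rw [ZMod.natCast_eq_natCast_iff']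
          rcases le_total t t' with h | h
          · exact ((additive_frozen hq.pos hS hz h).2).symm
          · exact (additive_frozen hq.pos hS (hflag.1 hz) h).2
        rw [h1, h2] at hyy
        exact natCast_zmod_injOn ht ht' (mul_right_cancel₀ ha (add_left_cancel hyy))
      · rw [(additive_moving hq.pos hS hz).2] at h1
        rw [(additive_moving hq.pos hS (mt hflag.2 hz)).2] at h2
        by_contra htt
        have hsub : (t : ZMod q) - t' ≠ 0 :=
          sub_ne_zero.2 fun h => htt (natCast_zmod_injOn ht ht' h)
        have hmul : ((t : ZMod q) - t') *
            (((S 0 y / q : ℕ) : ZMod q) - ((S 0 v / q : ℕ) : ZMod q)) = 0 := by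
          linear_combination h1 - h2
        have hdiv := sub_eq_zero.1 ((mul_eq_zero.1 hmul).resolve_left hsub)
        rw [hdiv] at h1
        have hmod := (ZMod.natCast_eq_natCast_iff' _ _ _).1 (add_right_cancel h1)
        have hdiv' := natCast_zmod_injOn (hlt y (hG.right_mem hadj)) (hlt v hv) hdiv
        exact h0.ne hadj (by rw [← Nat.div_add_mod (S 0 y) q, hdiv', hmod, Nat.div_add_mod]))
  rw [Finset.card_range, Finset.card_product, ← Set.ncard_eq_toFinset_card _ _, Finset.card_univ,
    Fintype.card_bool] at hcard
  have := hG.ncard_neighborSet_le v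
  omega

end additiveRun

/-- The colour reduction of Barenboim, Elkin and Goldenberg. -/
theorem ReducesColors.of_sq_prime {D q : ℕ} (hq : q.Prime) (hD : 2 * D < q) :
    ReducesColors.{u} D (q ^ 2) q q := by
  refine ⟨List.replicate q (additiveRule q), by simp, fun α G V s hG hs => ?_⟩
  let S : ℕ → α → ℕ := fun t => run G (List.replicate t (additiveRule q)) s
  have hS : ∀ t, S (t + 1) = (additiveRule q).apply G (S t) := fun t => by
    simp only [S]
    rw [List.replicate_succ', run_concat]
  constructor
  · intro v hv
    have h := additive_finished hq hG hD hS hs hv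
    exact (Nat.div_eq_zero_iff.1 h).resolve_left hq.ne_zero
  · have : ∀ t, ∀ {u v}, G.Adj u v → S t u ≠ S t v := by
      intro t
      induction t with
      | zero => exact hs.ne
      | succ t ih =>
        intro u v huv
        rw [hS]
        exact additiveRule_apply_ne hq.pos ih huv
    exact fun {u v} huv => this q huv

/-! ### The underlying graph of a hypergraph -/

namespace Hypergraph

variable {α : Type u} {H : Hypergraph α}

theorem ncard_le_rank (hV : H.vertexSet.Finite) {e : Set α} (he : e ∈ H.edgeSet) :
    e.ncard ≤ H.rank :=
  le_csSup ((hV.finite_subsets.subset H.edgeSet_subset_powerset_vertexSet).image _).bddAbove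
    ⟨e, he, rfl⟩

theorem degree_le_maxDegree (hV : H.vertexSet.Finite) {v : α} (hv : v ∈ H.vertexSet) :
    H.degree v ≤ H.maxDegree :=
  le_csSup (hV.image _).bddAbove ⟨v, hv, rfl⟩

theorem isBoundedNetwork (hV : H.vertexSet.Finite) :
    IsBoundedNetwork H.underlyingGraph H.vertexSet (H.maxDegree * (H.rank - 1)) := by
  have hleft : ∀ {u v}, H.underlyingGraph.Adj u v → u ∈ H.vertexSet := by
    rintro u v ⟨-, e, he, hu, -⟩
    exact mem_vertexSet_of_mem_edgeSet he hu
  have hfin : ∀ v, (H.underlyingGraph.neighborSet v).Finite := fun v =>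
    hV.subset fun w hw => hleft (SimpleGraph.Adj.symm hw)
  refine ⟨hleft, hfin, fun v => ?_⟩
  by_cases hv : v ∈ H.vertexSet
  · have hE : {e ∈ H.edgeSet | v ∈ e}.Finite :=
      (hV.finite_subsets.subset H.edgeSet_subset_powerset_vertexSet).subset fun e he => he.1
    have hsub : H.underlyingGraph.neighborSet v ⊆
        ⋃ e ∈ hE.toFinset, (e \ {v}) := by
      rintro w ⟨hne, e, he, hve, hwe⟩
      simp only [Set.mem_iUnion, Set.Finite.mem_toFinset]
      exact ⟨e, ⟨he, hve⟩, hwe, fun h => hne h.symm⟩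
    have hfe : ∀ e ∈ hE.toFinset, (e \ {v}).Finite := fun e he =>
      (hV.subset (subset_vertexSet_of_mem_edgeSet (by simpa using he : _ ∧ _).1)).sdiff
    calc (H.underlyingGraph.neighborSet v).ncard
        ≤ (⋃ e ∈ hE.toFinset, (e \ {v})).ncard :=
          Set.ncard_le_ncard hsub (hE.toFinset.finite_toSet.biUnion hfe)
      _ ≤ ∑ e ∈ hE.toFinset, (e \ {v}).ncard := Finset.set_ncard_biUnion_le _ _
      _ ≤ ∑ e ∈ hE.toFinset, (H.rank - 1) := by
          refine Finset.sum_le_sum fun e he => ?_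
          have he : e ∈ H.edgeSet ∧ v ∈ e := by simpa using he
          rw [Set.ncard_sdiff_singleton_of_mem he.2]
          exact Nat.sub_le_sub_right (ncard_le_rank hV he.1) 1
      _ = H.degree v * (H.rank - 1) := by
          rw [Finset.sum_const, smul_eq_mul, ← Set.ncard_eq_toFinset_card _ hE]; rfl
      _ ≤ _ := Nat.mul_le_mul_right _ (degree_le_maxDegree hV hv)
  · have : H.underlyingGraph.neighborSet v = ∅ :=
      Set.eq_empty_of_forall_notMem fun w hw => hv (hleft hw)
    simp [this]

theorem two_le_dist {u v : α} (hne : u ≠ v) (h : ¬ H.underlyingGraph.Adj u v) :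
    ((2 : ℕ) : ℕ∞) ≤ H.dist u v := by
  by_contra! hlt
  rw [dist] at hlt
  obtain ⟨d, hd⟩ := ENat.ne_top_iff_exists.1 hlt.ne_top
  rw [← hd, Nat.cast_lt] at hlt
  interval_cases d
  · exact hne (SimpleGraph.edist_eq_zero_iff.1 hd.symm)
  · exact h (SimpleGraph.edist_eq_one_iff_adj.1 hd.symm)

end Hypergraph

theorem IsBoundedNetwork.mono {α : Type u} {G : SimpleGraph α} {V : Set α} {D D' : ℕ}
    (h : IsBoundedNetwork G V D) (hD : D ≤ D') : IsBoundedNetwork G V D' :=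
  ⟨h.left_mem, h.finite_neighborSet, fun v => (h.ncard_neighborSet_le v).trans hD⟩

/-! ### LOCAL algorithms from recolouring rounds -/

namespace LocalAlgorithm

/-- The algorithm that starts with the IDs as colours, applies the rounds in `fs`, and puts the
vertices with final colours below `M` into the output set. -/
def ofRules (fs : List ColorRule) (M : ℕ) : LocalAlgorithm where
  State := List ColorRule × ℕ
  Msg := ℕ
  init i _ := (fs, i)
  send s _ := s.2
  -- Once the list is exhausted, the default rule keeps the colour.
  receive s R := (s.1.tail, (s.1.headD fun x _ => x) s.2 (Prod.snd '' R))
  accept s := s.2 < M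

theorem run_ofRules {α : Type u} (fs : List ColorRule) (M : ℕ) (H : Hypergraph α) (ident : α → ℕ)
    (t : ℕ) (v : α) : (ofRules fs M).run H ident t v =
      (fs.drop t, ColorRule.run H.underlyingGraph (fs.take t) ident v) := by
  induction t generalizing v with
  | zero => rfl
  | succ t ih =>
    have hR : Prod.snd '' {p : ℕ × ℕ | ∃ w, H.underlyingGraph.Adj v w ∧ p = (ident w,
        ColorRule.run H.underlyingGraph (fs.take t) ident w)} =
        ColorRule.run H.underlyingGraph (fs.take t) ident '' H.underlyingGraph.neighborSet v := by
      ext x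
      constructor
      · rintro ⟨_, ⟨w, hw, rfl⟩, rfl⟩
        exact ⟨w, hw, rfl⟩
      · rintro ⟨w, hw, rfl⟩
        exact ⟨_, ⟨w, hw, rfl⟩, rfl⟩
    have hstep : (ofRules fs M).run H ident (t + 1) v =
        ((fs.drop t).tail, ((fs.drop t).headD fun x _ => x)
          (ColorRule.run H.underlyingGraph (fs.take t) ident v)
          (Prod.snd '' {p : ℕ × ℕ | ∃ w, H.underlyingGraph.Adj v w ∧ p = (ident w,
            ColorRule.run H.underlyingGraph (fs.take t) ident w)})) := by
      simp only [LocalAlgorithm.run, ih]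
      rfl
    rw [hstep, hR, List.tail_drop]
    by_cases ht : t < fs.length
    · rw [List.take_succ_eq_append_getElem ht, run_concat, List.drop_eq_getElem_cons ht]
      rfl
    · rw [List.drop_eq_nil_of_le (by omega : fs.length ≤ t + 1),
        List.drop_eq_nil_of_le (by omega : fs.length ≤ t), List.take_of_length_le (by omega : fs.length ≤ t),
        List.take_of_length_le (by omega : fs.length ≤ t + 1)]
      rfl

theorem mem_outputSet_ofRules {α : Type u} {fs : List ColorRule} {M : ℕ} {H : Hypergraph α}
    {ident : α → ℕ} {v : α} : v ∈ (ofRules fs M).outputSet H ident fs.length ↔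
      v ∈ H.vertexSet ∧ ColorRule.run H.underlyingGraph fs ident v < M := by
  simp only [outputSet, Set.mem_ofPred_eq, run_ofRules, List.take_length]
  rfl

theorem isProperColoring_ident {α : Type u} {H : Hypergraph α} {ident : α → ℕ} {m D : ℕ}
    (hG : IsBoundedNetwork H.underlyingGraph H.vertexSet D)
    (hinj : Set.InjOn ident H.vertexSet) (hle : ∀ v ∈ H.vertexSet, ident v ≤ m) :
    IsProperColoring H.underlyingGraph H.vertexSet (m + 1) ident :=
  ⟨fun v hv => Nat.lt_succ_of_le (hle v hv),
    fun huv h => huv.ne (hinj (hG.left_mem huv) (hG.right_mem huv) h)⟩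

/-- In a hypergraph without adjacent vertices the set of all vertices is a ruling set. -/
theorem exists_findsRulingSet_zero {c n Δ r : ℕ} (b : ℕ) (h : Δ * (r - 1) = 0) :
    ∃ A : LocalAlgorithm, FindsRulingSet.{u} A c n Δ r 2 b 0 := by
  refine ⟨ofRules [] (n ^ c + 1), fun α H ident hfin _ hΔ hr _ hle => ?_⟩
  have hG := H.isBoundedNetwork hfin
  rw [hΔ, hr, h] at hG
  refine ⟨fun v hv => hv.1, fun u _ v _ hne => Hypergraph.two_le_dist hne fun huv => ?_,
    fun v hv => ⟨v, mem_outputSet_ofRules.2 ⟨hv, Nat.lt_succ_of_le (hle v hv)⟩, ?_⟩⟩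
  · have := (Set.ncard_eq_zero (hG.finite_neighborSet u)).1
      (Nat.le_zero.1 (hG.ncard_neighborSet_le u))
    exact Set.notMem_empty v (this ▸ huv)
  · simp [Hypergraph.dist]

theorem exists_findsRulingSet {c n Δ r D B k T : ℕ} (hB : 0 < B) (hD : Δ * (r - 1) ≤ D)
    (h : ReducesColors.{u} D (n ^ c + 1) (B ^ k) T) :
    ∃ (A : LocalAlgorithm) (T' : ℕ), T' ≤ T + k * B ∧ FindsRulingSet.{u} A c n Δ r 2 k T' := by
  obtain ⟨fs, hfs, hf⟩ := h
  obtain ⟨gs, hgs, hg⟩ := exists_rules_ruling.{u} B k D hB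
  refine ⟨ofRules (fs ++ gs) (B ^ k), (fs ++ gs).length, by rw [List.length_append]; omega,
    fun α H ident hfin _ hΔ hr hinj hle => ?_⟩
  have hG : IsBoundedNetwork H.underlyingGraph H.vertexSet D :=
    (H.isBoundedNetwork hfin).mono (by rw [hΔ, hr]; exact hD)
  obtain ⟨hind, hdom⟩ := hg α _ _ _ hG (hf α _ _ _ hG (isProperColoring_ident hG hinj hle))
  rw [← run_append] at hind hdom
  refine ⟨fun v hv => hv.1, fun u hu v hv hne => Hypergraph.two_le_dist hne ?_, fun v hv => ?_⟩
  · exact hind u v (mem_outputSet_ofRules.1 hu).2 (mem_outputSet_ofRules.1 hv).2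
  · obtain ⟨u, hu, hlt, hd⟩ := hdom v hv
    exact ⟨u, mem_outputSet_ofRules.2 ⟨hu, hlt⟩, hd⟩

/-- A ruling set is found by splitting colours into `k` digits, if `ρ ^ k ≥ r ^ 2`. -/
theorem exists_findsRulingSet_of_sq_le {c K n Δ r k ρ : ℕ} (hK : 0 < K)
    (hred : ∀ D : ℕ, K ≤ D →
      ReducesColors.{u} D (n ^ c + 1) (64 * D ^ 2) (2 * logStar n + 4))
    (hΔ : 0 < Δ) (hr : 0 < r) (hk : 2 ≤ k) (hρ : r ^ 2 ≤ ρ ^ k) :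
    ∃ (A : LocalAlgorithm) (T : ℕ), T ≤ 2 * logStar n + 4 + 8 * K * Δ * (k * ρ) ∧
      FindsRulingSet.{u} A c n Δ r 2 k T := by
  have hρ0 : 0 < ρ := by
    rcases Nat.eq_zero_or_pos ρ with rfl | h
    · rw [zero_pow (by omega)] at hρ
      exact absurd hρ (Nat.not_le.2 (by positivity))
    · exact h
  -- Here `k ≥ 2` matters: the square of `8 * K * Δ` is absorbed by its `k`-th power, so only `r ^
  -- 2` has to be spread over the digits.
  have hcol : 64 * (K * (Δ * r)) ^ 2 ≤ (8 * K * Δ * ρ) ^ k :=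
    calc 64 * (K * (Δ * r)) ^ 2 = (8 * K * Δ) ^ 2 * r ^ 2 := by ring
      _ ≤ (8 * K * Δ) ^ k * ρ ^ k :=
        Nat.mul_le_mul (Nat.pow_le_pow_right (by positivity) hk) hρ
      _ = _ := by rw [mul_pow _ ρ]
  obtain ⟨A, T, hT, hA⟩ := exists_findsRulingSet (Δ := Δ) (r := r) (by positivity)
    ((Nat.mul_le_mul_left Δ (Nat.sub_le r 1)).trans (Nat.le_mul_of_pos_left _ hK))
    ((hred (K * (Δ * r)) (Nat.le_mul_of_pos_right _ (by positivity))).mono le_rfl hcol le_rfl)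
  exact ⟨A, T, hT.trans_eq (by ring), hA⟩

/-- A maximal independent set is found in time linear in the degree of the underlying graph. -/
theorem exists_findsRulingSet_one {c K n Δ r : ℕ} (hK : 0 < K)
    (hred : ∀ D : ℕ, K ≤ D →
      ReducesColors.{u} D (n ^ c + 1) (64 * D ^ 2) (2 * logStar n + 4))
    (hΔ : 0 < Δ) (hr : 0 < r) :
    ∃ (A : LocalAlgorithm) (T : ℕ), T ≤ 2 * logStar n + 4 + 32 * K * Δ * r ∧
      FindsRulingSet.{u} A c n Δ r 2 1 T := by
  have hD : 0 < K * (Δ * r) := by positivity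
  obtain ⟨q, hq, hlt, hle⟩ := Nat.exists_prime_lt_and_le_two_mul (8 * (K * (Δ * r))) (by positivity)
  -- The prime `q` is large enough for its square to cover Linial's palette, and linear in `Δ * r`.
  have hcol : 64 * (K * (Δ * r)) ^ 2 ≤ q ^ 2 :=
    calc 64 * (K * (Δ * r)) ^ 2 = (8 * (K * (Δ * r))) ^ 2 := by ring
      _ ≤ _ := Nat.pow_le_pow_left hlt.le 2
  obtain ⟨A, T, hT, hA⟩ := exists_findsRulingSet (Δ := Δ) (r := r) (k := 1) hq.pos
    ((Nat.mul_le_mul_left Δ (Nat.sub_le r 1)).trans (Nat.le_mul_of_pos_left _ hK))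
    (((hred (K * (Δ * r)) (Nat.le_mul_of_pos_right _ (by positivity))).mono le_rfl hcol
      le_rfl).trans ((ReducesColors.of_sq_prime hq (by omega)).mono le_rfl
        (pow_one q).ge le_rfl))
  refine ⟨A, T, hT.trans ?_, hA⟩
  calc 2 * logStar n + 4 + q + 1 * q = 2 * logStar n + 4 + 2 * q := by ring
    _ ≤ 2 * logStar n + 4 + 2 * (2 * (8 * (K * (Δ * r)))) := by gcongr
    _ = _ := by ring

end LocalAlgorithm

/-! ### Numerical estimates -/

/-- Used with `k = j + 2` and `y = r ^ (1 / k)`. The threshold 3 makes `2 / 3 * y ≥ 2`, so the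
exponential term dominates `j + 1`; below it `y ^ 2 ≤ 9`. -/
theorem add_two_mul_sq_le {y : ℝ} (hy : 0 ≤ y) (j : ℕ) :
    ((j : ℝ) + 2) * y ^ 2 ≤ 9 * ((j : ℝ) + 2 + (2 / 3) ^ (j + 1) * y ^ (j + 2)) := by
  rcases le_total y 3 with h | h
  · have h1 : y ^ 2 ≤ 9 := by nlinarith
    have h2 : 0 ≤ (2 / 3 : ℝ) ^ (j + 1) * y ^ (j + 2) := by positivity
    have h3 : (0 : ℝ) ≤ (j : ℝ) + 2 := by positivity
    nlinarith
  · have h1 : (2 : ℝ) ^ j ≤ (2 / 3 * y) ^ j := pow_le_pow_left₀ (by norm_num) (by linarith) j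
    have h2 : (j : ℝ) + 1 ≤ 2 ^ j := by exact_mod_cast Nat.lt_two_pow_self (n := j)
    have h3 : (2 / 3 : ℝ) ^ (j + 1) * y ^ (j + 2) = 2 / 3 * y ^ 2 * (2 / 3 * y) ^ j := by
      rw [mul_pow]; ring
    have hj : (0 : ℝ) ≤ j := Nat.cast_nonneg j
    have h4 : y ^ 2 * ((j : ℝ) + 1) ≤ y ^ 2 * (2 / 3 * y) ^ j :=
      mul_le_mul_of_nonneg_left (h2.trans h1) (by positivity)
    have h5 : 0 ≤ y ^ 2 * (j : ℝ) := by positivity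
    have h6 : 0 ≤ y ^ 2 := by positivity
    rw [h3]
    nlinarith

/-- A base for numerals with `k` digits up to `r ^ 2`, namely `r ^ (2 / k)` rounded up. -/
theorem exists_base (r k : ℕ) (hr : 1 ≤ r) (hk : 2 ≤ k) : ∃ ρ : ℕ, r ^ 2 ≤ ρ ^ k ∧
    (k : ℝ) * ρ ≤ 18 * (k + (2 / 3 : ℝ) ^ (k - 1) * r) := by
  have hr' : (1 : ℝ) ≤ r := by exact_mod_cast hr
  set y : ℝ := (r : ℝ) ^ ((k : ℝ)⁻¹) with hy
  have hy1 : 1 ≤ y := Real.one_le_rpow hr' (by positivity)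
  have hyk : y ^ k = r := Real.rpow_inv_natCast_pow (by positivity) (by omega)
  refine ⟨⌈y ^ 2⌉₊, ?_, ?_⟩
  · have h : ((r : ℝ)) ^ 2 ≤ (⌈y ^ 2⌉₊ : ℝ) ^ k := by
      rw [← hyk, ← pow_mul, mul_comm, pow_mul]
      exact pow_le_pow_left₀ (by positivity) (Nat.le_ceil _) k
    exact_mod_cast h
  · have h1 : (⌈y ^ 2⌉₊ : ℝ) ≤ 2 * y ^ 2 := by
      have := Nat.ceil_lt_add_one (sq_nonneg y)
      nlinarith
    obtain ⟨j, rfl⟩ := Nat.exists_eq_add_of_le' hk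
    have h2 := add_two_mul_sq_le (zero_le_one.trans hy1) j
    rw [hyk] at h2
    rw [show j + 2 - 1 = j + 1 by omega]
    have h3 : ((j + 2 : ℕ) : ℝ) * ⌈y ^ 2⌉₊ ≤ ((j + 2 : ℕ) : ℝ) * (2 * y ^ 2) :=
      mul_le_mul_of_nonneg_left h1 (by positivity)
    push_cast at h3 ⊢
    linarith

theorem half_le_log {r : ℕ} (hr : 2 ≤ r) : 1 / 2 ≤ Real.log r := by
  have h := Real.log_le_log two_pos (show (2 : ℝ) ≤ r by exact_mod_cast hr)
  have := Real.log_two_gt_d9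
  linarith

theorem clog_two_le_four_mul_log {r : ℕ} (hr : 2 ≤ r) :
    (Nat.clog 2 r : ℝ) ≤ 4 * Real.log r := by
  have h1 : (2 : ℝ) ^ (Nat.clog 2 r).pred ≤ r := by
    exact_mod_cast (Nat.pow_pred_clog_lt_self one_lt_two (x := r) (by omega)).le
  have h2 := Real.log_le_log (by positivity) h1
  rw [Real.log_pow] at h2
  have h3 : (Nat.clog 2 r : ℝ) ≤ ((Nat.clog 2 r).pred : ℝ) + 1 := by
    exact_mod_cast Nat.le_succ_of_pred_le le_rfl
  have h4 := Real.log_two_gt_d9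
  have h5 := half_le_log hr
  have h6 : (0 : ℝ) ≤ ((Nat.clog 2 r).pred : ℝ) := Nat.cast_nonneg _
  nlinarith

/-! ### The main theorem -/

theorem mainTheorem9 (c : ℕ) :
    ∃ C : ℝ,
      (∀ n Δ r : ℕ, ∃ (A : LocalAlgorithm) (b T : ℕ),
        (b : ℝ) ≤ C * Real.log r ∧
        (T : ℝ) ≤ C * (Δ * Real.log r + logStar n) ∧
        LocalAlgorithm.FindsRulingSet.{u} A c n Δ r 2 b T) ∧
      (∀ n Δ r k : ℕ, 1 ≤ k → ∃ (A : LocalAlgorithm) (T : ℕ),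
        (T : ℝ) ≤ C * (Δ * (k + (2 / 3 : ℝ) ^ (k - 1) * r) + logStar n) ∧
        LocalAlgorithm.FindsRulingSet.{u} A c n Δ r 2 k T) := by
  obtain ⟨K, hK, hred⟩ := exists_reducesColors_sq.{u} c
  have hK1 : (1 : ℝ) ≤ K := by exact_mod_cast hK
  refine ⟨200 * K, fun n Δ r => ?_, fun n Δ r k hk => ?_⟩
  · have hlog : 0 ≤ Real.log r := Real.log_natCast_nonneg r
    -- Without adjacent vertices zero rounds suffice. Otherwise `Δ ≥ 1` and `r ≥ 2`, so `Δ * log r`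
    -- is bounded below and absorbs the additive 4.
    by_cases h0 : Δ * (r - 1) = 0
    · obtain ⟨A, hA⟩ := LocalAlgorithm.exists_findsRulingSet_zero.{u} (c := c) (n := n) 0 h0
      refine ⟨A, 0, 0, ?_, ?_, hA⟩ <;> rw [Nat.cast_zero] <;> positivity
    obtain ⟨hΔ, hr⟩ : 0 < Δ ∧ 2 ≤ r := by
      rw [Nat.mul_eq_zero, not_or] at h0
      omega
    -- The choice `ρ = 2` keeps the base at O(Δ), with O(log r) digits.
    have hsq : r ^ 2 ≤ 2 ^ (2 * Nat.clog 2 r) := by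
      rw [mul_comm, pow_mul]
      exact Nat.pow_le_pow_left (Nat.le_pow_clog one_lt_two r) 2
    have hclog : 0 < Nat.clog 2 r := Nat.clog_pos one_lt_two hr
    obtain ⟨A, T, hT, hA⟩ := LocalAlgorithm.exists_findsRulingSet_of_sq_le hK (hred n) hΔ
      (by omega) (by omega) hsq
    have h1 := clog_two_le_four_mul_log hr
    have h2 := half_le_log hr
    have hT' : (T : ℝ) ≤ 2 * logStar n + 4 + 8 * K * Δ * (2 * Nat.clog 2 r * 2) := by
      exact_mod_cast hT
    have hΔ1 : (1 : ℝ) ≤ Δ := by exact_mod_cast hΔ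
    have hKΔ : (1 : ℝ) ≤ K * Δ := one_le_mul_of_one_le_of_one_le hK1 hΔ1
    have hls : (0 : ℝ) ≤ logStar n := Nat.cast_nonneg _
    refine ⟨A, _, T, ?_, hT'.trans ?_, hA⟩
    · push_cast
      nlinarith
    · have h3 : (K * Δ : ℝ) * Nat.clog 2 r ≤ K * Δ * (4 * Real.log r) := by gcongr
      have h4 : 1 / 2 ≤ (K * Δ : ℝ) * Real.log r := by nlinarith
      have h5 : (logStar n : ℝ) ≤ K * logStar n := le_mul_of_one_le_left hls hK1
      linarith
  · by_cases h0 : Δ * (r - 1) = 0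
    · obtain ⟨A, hA⟩ := LocalAlgorithm.exists_findsRulingSet_zero.{u} (c := c) (n := n) k h0
      refine ⟨A, 0, ?_, hA⟩
      rw [Nat.cast_zero]
      positivity
    obtain ⟨hΔ, hr⟩ : 0 < Δ ∧ 2 ≤ r := by
      rw [Nat.mul_eq_zero, not_or] at h0
      omega
    have hΔ1 : (1 : ℝ) ≤ Δ := by exact_mod_cast hΔ
    have hKΔ : (1 : ℝ) ≤ K * Δ := one_le_mul_of_one_le_of_one_le hK1 hΔ1
    have hls : (0 : ℝ) ≤ logStar n := Nat.cast_nonneg _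
    have h5 : (logStar n : ℝ) ≤ K * logStar n := le_mul_of_one_le_left hls hK1
    rcases hk.eq_or_lt with rfl | hk
    · obtain ⟨A, T, hT, hA⟩ := LocalAlgorithm.exists_findsRulingSet_one hK (hred n) hΔ
        (show 0 < r by omega)
      have hT' : (T : ℝ) ≤ 2 * logStar n + 4 + 32 * K * Δ * r := by exact_mod_cast hT
      refine ⟨A, T, hT'.trans ?_, hA⟩
      have h6 : (0 : ℝ) ≤ K * Δ * r := by positivity
      rw [Nat.sub_self, pow_zero, Nat.cast_one, one_mul]
      linarith
    · obtain ⟨ρ, hρ, hb⟩ := exists_base r k (by omega) hk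
      obtain ⟨A, T, hT, hA⟩ := LocalAlgorithm.exists_findsRulingSet_of_sq_le hK (hred n) hΔ
        (by omega) hk hρ
      have hT' : (T : ℝ) ≤ 2 * logStar n + 4 + 8 * K * Δ * (k * ρ) := by exact_mod_cast hT
      refine ⟨A, T, hT'.trans ?_, hA⟩
      have hk2 : (1 : ℝ) ≤ k := by exact_mod_cast hk.le
      have h6 : (0 : ℝ) ≤ (2 / 3 : ℝ) ^ (k - 1) * r := by positivity
      have h7 := mul_le_mul_of_nonneg_left hb (zero_le_one.trans hKΔ)
      have h8 : (1 : ℝ) ≤ K * Δ * (k + (2 / 3 : ℝ) ^ (k - 1) * r) :=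
        one_le_mul_of_one_le_of_one_le hKΔ (by linarith)
      linarith
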